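/- Let $V:\mathbb R^d\to\mathbb R^d$ be continuously differentiable, $L$-Lipschitz and $\mu$-strongly monotone with $\mu>0$, i.e. $\langle z-z',V(z)-V(z')\rangle\ge\mu\|z-z'\|^2$ for all $z,z'$; let $J$ be its Jacobian. Let $(\gamma_n)_{n\ge1}$ be positive step sizes with $\sum_n\gamma_n=\infty$. On a probability space with a filtration $(\mathcal F_n)$ let $(z_n)_{n\ge0}$ be $\mathcal F_n$-adapted iterates of (stochastic) OGDA, $$z_{n+1}=z_n-2\gamma_nV(z_n)+\gamma_nV(z_{n-1})+\gamma_n\mathcal R_{n+1}\qquad(n\ge1),$$ where $\mathcal R_{n+1}$ is square-integrable noise with $\mathbb E[\mathcal R_{n+1}\mid\mathcal F_n]=0$ and $\mathbb E[\|\mathcal R_{n+1}\|^2\mid\mathcal F_n]\le\sigma_n^2$ almost surely ($\mathcal R=0$ is deterministic OGDA). Write $B_n=\|-V(z_n)+V(z_{n-1})\|$ for the size of the bias of step $n$ relative to $z_{n+1}=z_n-\gamma_nV(z_n)$. Let $\gamma:[0,\infty)\to(0,\infty)$ be continuously differentiable (the step size function of the differential equation; constants are allowed) and $\beta(t)=2/\gamma(t)$.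 Assume * (A1) $\gamma_n^2\to0$ and $\sum_{n\ge1}\mathbb E[\gamma_nB_n]<\infty$; * (A2) $\sum_{n\ge1}\mathbb E[\gamma_n^2(1+B_n^2+\sigma_n^2)]<\infty$; * (A3) $\beta(t)\dot\beta(t)<2\mu$ for all $t\ge0$. Put $\tau_n=\sum_{k=1}^{n-1}\gamma_k$ and let $\bar z:[0,\infty)\to\mathbb R^d$ be the piecewise linear interpolation with $\bar z(\tau_n)=z_n$, i.e. $\bar z(t)=z_n+\frac{t-\tau_n}{\tau_{n+1}-\tau_n}(z_{n+1}-z_n)$ for $t\in[\tau_n,\tau_{n+1}]$, $n\ge1$. Consider the high-resolution differential equation of OGDA in its two forms: 1. $\dot z=\omega,\quad \dot\omega=-\frac2{\gamma(t)}\,\omega-\frac2{\gamma(t)}V(z)-2J(z)\,\omega$, started with $\omega=0$; 2. $\dot z=-\frac1{\gamma(t)}(z+w)-2V(z),\quad \dot w=-\frac1{\gamma(t)}(z+w)$, started with $w=-z$. For each of the two, for every starting time $s\ge0$ and every starting position $x\in\mathbb R^d$ (with the indicated initial value of the auxiliary variable), a solution exists on $[s,\infty)$ and its position component is unique; let $\Phi^{s}_h(x)$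 be its position at time $s+h$. Then, almost surely, $\bar z$ is an asymptotic pseudotrajectory of this flow, uniformly in the starting time: for every $T>0$, $$\lim_{t\to\infty}\ \sup_{s\ge0}\ \sup_{0\le h\le T}\ \big\|\bar z(t+h)-\Phi^{s}_h(\bar z(t))\big\|=0 .$$ In particular this holds with $s=t$, and when $\gamma$ is constant (autonomous equation), where $\Phi^s_h=\Phi_h$ does not depend on $s$. -/

import Mathlib

open Filter Topology MeasureTheory Set
open scoped NNReal ENNReal

/-- `V` is `μ`-strongly monotone. -/
def StronglyMonotone {d : ℕ}
    (V : EuclideanSpace ℝ (Fin d) → EuclideanSpace ℝ (Fin d)) (μ : ℝ) : Prop :=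
  ∀ z z', μ * ‖z - z'‖ ^ 2 ≤ inner ℝ (z - z') (V z - V z')

/-- The effective times `τ_n = γ_1 + ⋯ + γ_{n-1}` (so `τ_1 = 0` and `τ_{n+1} - τ_n = γ_n`). -/
noncomputable def effTime (γ : ℕ → ℝ) (n : ℕ) : ℝ := ∑ k ∈ Finset.Ico 1 n, γ k

/-- The largest index `n ≥ 1` with `τ_n ≤ t`. -/
noncomputable def lastIndex (γ : ℕ → ℝ) (t : ℝ) : ℕ := sSup {n : ℕ | 1 ≤ n ∧ effTime γ n ≤ t}

/-- The piecewise linear interpolation of the points `x_1, x_2, …` placed at the times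
`τ_1, τ_2, …`; the formula on each `[τ_n, τ_{n+1}]` is `interpolation_eq`. -/
noncomputable def interpolation {E : Type*} [AddCommGroup E] [Module ℝ E]
    (γ : ℕ → ℝ) (x : ℕ → E) (t : ℝ) : E :=
  x (lastIndex γ t) +
    ((t - effTime γ (lastIndex γ t)) /
        (effTime γ (lastIndex γ t + 1) - effTime γ (lastIndex γ t))) •
      (x (lastIndex γ t + 1) - x (lastIndex γ t))

theorem effTime_succ (γ : ℕ → ℝ) {n : ℕ} (hn : 1 ≤ n) :
    effTime γ (n + 1) = effTime γ n + γ n :=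
  Finset.sum_Ico_succ_top hn γ

theorem effTime_lt {γ : ℕ → ℝ} (hγ : ∀ n, 1 ≤ n → 0 < γ n) {m n : ℕ} (hm : 1 ≤ m)
    (hmn : m < n) : effTime γ m < effTime γ n := by
  induction n, hmn using Nat.le_induction with
  | base =>
    rw [effTime_succ γ hm]
    linarith [hγ m hm]
  | succ k hk ih =>
    have hk1 : 1 ≤ k := by omega
    rw [effTime_succ γ hk1]
    linarith [hγ k hk1]

theorem lastIndex_eq {γ : ℕ → ℝ} (hγ : ∀ n, 1 ≤ n → 0 < γ n) {n : ℕ} (hn : 1 ≤ n) {t : ℝ}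
    (h1 : effTime γ n ≤ t) (h2 : t < effTime γ (n + 1)) : lastIndex γ t = n := by
  refine IsGreatest.csSup_eq ⟨⟨hn, h1⟩, ?_⟩
  rintro m ⟨hm, hmt⟩
  by_contra hlt
  have hnm : n + 1 ≤ m := by omega
  rcases hnm.eq_or_lt with h | h
  · rw [← h] at hmt
    linarith
  · linarith [effTime_lt hγ (by omega : 1 ≤ n + 1) h]

/-- The defining formula of the piecewise linear interpolation. -/
theorem interpolation_eq {E : Type*} [AddCommGroup E] [Module ℝ E] {γ : ℕ → ℝ}
    (hγ : ∀ n, 1 ≤ n → 0 < γ n) (x : ℕ → E) {n : ℕ} (hn : 1 ≤ n) {t : ℝ}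
    (ht : t ∈ Icc (effTime γ n) (effTime γ (n + 1))) :
    interpolation γ x t =
      x n + ((t - effTime γ n) / (effTime γ (n + 1) - effTime γ n)) • (x (n + 1) - x n) := by
  rcases ht.2.lt_or_eq with h | h
  · rw [interpolation, lastIndex_eq hγ hn ht.1 h]
  · have hlt := effTime_lt hγ hn (Nat.lt_succ_self n)
    have hlt' := effTime_lt hγ (by omega : 1 ≤ n + 1) (Nat.lt_succ_self (n + 1))
    have hi : lastIndex γ t = n + 1 :=
      lastIndex_eq hγ (by omega) h.ge (by rw [h]; exact hlt')
    rw [interpolation, hi, h, sub_self, zero_div, zero_smul, div_self (by linarith), one_smul]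
    abel

/-- `z` follows optimistic gradient descent ascent with step sizes `γ_n` and noise `R`:
`z_{n+1} = z_n - 2 γ_n V(z_n) + γ_n V(z_{n-1}) + γ_n R_{n+1}` for `n ≥ 1`
(`z_0`, `z_1` are the initial points; `R = 0` is the deterministic method). -/
def IsOGDA {d : ℕ} {Ω : Type*} (V : EuclideanSpace ℝ (Fin d) → EuclideanSpace ℝ (Fin d))
    (γ : ℕ → ℝ) (R z : ℕ → Ω → EuclideanSpace ℝ (Fin d)) : Prop :=
  ∀ n, 1 ≤ n → ∀ ω, z (n + 1) ω =
    z n ω - (2 * γ n) • V (z n ω) + γ n • V (z (n - 1) ω) + γ n • R (n + 1) ω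

/-- The bias `-V(z_n) + V(z_{n-1})` of the `n`-th step (`n ≥ 1`) of OGDA, regarded as the
Robbins–Monro scheme `z_{n+1} = z_n + γ_n (-V(z_n) + bias + noise)`. -/
def ogdaBias {d : ℕ} {Ω : Type*} (V : EuclideanSpace ℝ (Fin d) → EuclideanSpace ℝ (Fin d))
    (z : ℕ → Ω → EuclideanSpace ℝ (Fin d)) (n : ℕ) (ω : Ω) : EuclideanSpace ℝ (Fin d) :=
  -V (z n ω) + V (z (n - 1) ω)

/-- `(z, ω)` solves on `[s, ∞)` the high-resolution differential equation of OGDA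
`ż = ω`, `ω̇ = -(2/γ(t)) ω - (2/γ(t)) V(z) - 2 J(z) ω`, with `J` the Jacobian of `V`. -/
def IsHRDESolution {d : ℕ} (V : EuclideanSpace ℝ (Fin d) → EuclideanSpace ℝ (Fin d))
    (γ : ℝ → ℝ) (s : ℝ) (z ω : ℝ → EuclideanSpace ℝ (Fin d)) : Prop :=
  ∀ t ∈ Ici s,
    HasDerivWithinAt z (ω t) (Ici s) t ∧
    HasDerivWithinAt ω
      (-((2 / γ t) • ω t) - (2 / γ t) • V (z t) - (2 : ℝ) • fderiv ℝ V (z t) (ω t)) (Ici s) t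

/-- `(z, w)` solves on `[s, ∞)` the Jacobian-free form of the high-resolution differential
equation of OGDA, `ż = -κ(t) z - κ(t) w - 2 V(z)`, `ẇ = -κ(t) z - κ(t) w`, `κ(t) = 1/γ(t)`. -/
def IsHRDE2Solution {d : ℕ} (V : EuclideanSpace ℝ (Fin d) → EuclideanSpace ℝ (Fin d))
    (γ : ℝ → ℝ) (s : ℝ) (z w : ℝ → EuclideanSpace ℝ (Fin d)) : Prop :=
  ∀ t ∈ Ici s,
    HasDerivWithinAt z
      (-((1 / γ t) • z t) - (1 / γ t) • w t - (2 : ℝ) • V (z t)) (Ici s) t ∧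
    HasDerivWithinAt w (-((1 / γ t) • z t) - (1 / γ t) • w t) (Ici s) t

/-- `Φ` is the position flow of a (time dependent) system in the unknowns `(z, y)`, whose
solutions on `[s, ∞)` are singled out by `Sol s`, with the auxiliary variable initialised by
`y = init z`: for each starting time `s ≥ 0` and each point `x` the initial value problem
`z(s) = x`, `y(s) = init x` is solvable on `[s, ∞)`, and `Φ s h x` is the position at time
`s + h` of each of its solutions (so the position is unique). -/
def IsPositionFlow {E : Type*} (Sol : ℝ → (ℝ → E) → (ℝ → E) → Prop) (init : E → E)
    (Φ : ℝ → ℝ → E → E) : Prop :=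
  ∀ s, 0 ≤ s → ∀ x,
    (∃ z y, Sol s z y ∧ z s = x ∧ y s = init x) ∧
    ∀ z y, Sol s z y → z s = x → y s = init x → ∀ h, 0 ≤ h → Φ s h x = z (s + h)

/-- `x` is an asymptotic pseudotrajectory of the time dependent flow `Φ` (`Φ s h p` is the
position, a time `h` later, of the solution that is at `p` at time `s`): for all `T > 0`,
`sup_{0 ≤ h ≤ T} ‖x(t + h) - Φ_h(x(t))‖ → 0` as `t → ∞`, uniformly in the time `s ≥ 0` at which
the flow is started. This includes starting it at `s = t` and at `s = 0`; for the flow of an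
autonomous equation, `s` plays no role and this is the usual notion. -/
def IsAPT {E : Type*} [NormedAddCommGroup E] (x : ℝ → E) (Φ : ℝ → ℝ → E → E) : Prop :=
  ∀ T : ℝ, 0 < T →
    Tendsto (fun t : ℝ => ⨆ s ∈ Ici (0 : ℝ), ⨆ h ∈ Icc 0 T, ‖x (t + h) - Φ s h (x t)‖ₑ)
      atTop (𝓝 0)

/-! Both sides of the comparison are close to one point, the zero `p` of `V`, so the discrete scheme
and the differential equation never have to be compared step by step. On the discrete side, OGDA is
a Robbins–Monro scheme for `-V`. The weighted bias is almost surely absolutely summable, and the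
weighted noise is a martingale bounded in L², so the accumulated perturbation converges. Strong
monotonicity then forces the iterates to `p` (`tendsto_of_stronglyMonotone`, `IsOGDA.ae_tendsto`),
and their interpolation follows. On the continuous side, a solution with the prescribed auxiliary
value that starts at distance `r` from `p` stays within `C(T) r` of `p` up to time `T`, with `C(T)`
independent of the starting time and of the step size function. For the second form the energy `‖z -
p‖² + ‖w + p‖²` decreases. For the first, with `u = ω + 2 V(z)`, the stiff term pulls `u` towards
`V(z)`, so it cannot enlarge `‖u‖` once `‖u‖ ≥ ‖V(z)‖`; a Grönwall bound for a maximum exploits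
this. `IsPositionFlow.isAPT` joins the two sides by the triangle inequality. -/

/-! ### Global Picard–Lindelöf for globally Lipschitz fields -/

section ODE

variable {E : Type*} [NormedAddCommGroup E] [NormedSpace ℝ E]

/-- Global Picard–Lindelöf theorem on a compact interval, for a vector field which is globally
Lipschitz in space. -/
theorem exists_solution_Icc [CompleteSpace E] {f : ℝ → E → E} (hf : Continuous (Function.uncurry f))
    {a b : ℝ} (hab : a ≤ b) {K : ℝ≥0} (hK : ∀ t ∈ Icc a b, LipschitzWith K (f t)) (x₀ : E) :
    ∃ X : ℝ → E, X a = x₀ ∧ ∀ t ∈ Icc a b, HasDerivAt X (f t (X t)) t := by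
  -- Bielecki's weight: the unknown is `y(t) = exp(-l (t - a)) X(t)`. For it the Picard map
  -- contracts the sup norm by `K / l < 1` on the whole interval, however long.
  set l : ℝ := K + 1 with hl
  have hl0 : 0 < l := by positivity
  let g : C(Icc a b, E) → ℝ → E :=
    fun y τ => f τ (Real.exp (l * (τ - a)) • IccExtend hab y τ)
  have hg : ∀ y, Continuous (g y) := by
    intro y
    have : Continuous (IccExtend hab y) := y.continuous.Icc_extend'
    exact hf.comp (continuous_id.prodMk (by fun_prop))
  have hG : ∀ y t, HasDerivAt (fun t => x₀ + ∫ τ in a..t, g y τ) (g y t) t := fun y t =>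
    ((hg y).integral_hasStrictDerivAt a t).hasDerivAt.const_add x₀
  let T : C(Icc a b, E) → C(Icc a b, E) := fun y =>
    ⟨fun t => Real.exp (-(l * (t - a))) • (x₀ + ∫ τ in a..(t : ℝ), g y τ), by
      have h : Continuous (fun t => x₀ + ∫ τ in a..t, g y τ) :=
        continuous_iff_continuousAt.2 fun t => (hG y t).continuousAt
      have h' := h.comp (continuous_subtype_val (p := fun t => t ∈ Icc a b))
      exact Continuous.smul (by fun_prop) h'⟩
  have hq : K / (K + 1) < 1 := (NNReal.div_lt_one_of_lt (lt_add_one K))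
  have hT : ContractingWith (K / (K + 1)) T := by
    refine ⟨hq, LipschitzWith.of_dist_le_mul fun y y' => ?_⟩
    rw [ContinuousMap.dist_le (by positivity)]
    rintro ⟨t, ht⟩
    have hint : ∫ τ in a..t, K * dist y y' * Real.exp (l * (τ - a)) =
        K * dist y y' * (Real.exp (l * (t - a)) / l - 1 / l) := by
      rw [intervalIntegral.integral_const_mul]
      congr 1
      rw [intervalIntegral.integral_eq_sub_of_hasDerivAt
        (f := fun τ => Real.exp (l * (τ - a)) / l)]
      · simp
      · intro τ _
        have := (((hasDerivAt_id τ).sub_const a).const_mul l).exp.div_const l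
        refine this.congr_deriv ?_
        simp [hl0.ne']
      · exact (by fun_prop : Continuous fun τ => Real.exp (l * (τ - a))).intervalIntegrable _ _
    have hbound : ‖∫ τ in a..t, (g y τ - g y' τ)‖ ≤
        K * dist y y' * (Real.exp (l * (t - a)) / l - 1 / l) := by
      rw [← hint]
      refine intervalIntegral.norm_integral_le_of_norm_le ht.1 ?_ ?_
      · refine Eventually.of_forall fun τ hτ => ?_
        have hτ' : τ ∈ Icc a b := ⟨hτ.1.le, hτ.2.trans ht.2⟩
        have h1 := (hK τ hτ').dist_le_mul (Real.exp (l * (τ - a)) • IccExtend hab y τ)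
          (Real.exp (l * (τ - a)) • IccExtend hab y' τ)
        rw [dist_smul₀, Real.norm_of_nonneg (Real.exp_pos _).le, dist_eq_norm] at h1
        refine h1.trans ?_
        have h2 : dist (IccExtend hab y τ) (IccExtend hab y' τ) ≤ dist y y' :=
          ContinuousMap.dist_apply_le_dist _
        have := Real.exp_pos (l * (τ - a))
        calc K * (Real.exp (l * (τ - a)) * dist (IccExtend hab y τ) (IccExtend hab y' τ))
            ≤ K * (Real.exp (l * (τ - a)) * dist y y') := by gcongr
          _ = _ := by ring
      · exact (by fun_prop : Continuous fun τ =>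
          K * dist y y' * Real.exp (l * (τ - a))).intervalIntegrable _ _
    have hsub : T y ⟨t, ht⟩ - T y' ⟨t, ht⟩ =
        Real.exp (-(l * (t - a))) • ∫ τ in a..t, (g y τ - g y' τ) := by
      rw [intervalIntegral.integral_sub ((hg y).intervalIntegrable _ _)
        ((hg y').intervalIntegrable _ _)]
      simp only [T, ContinuousMap.coe_mk, ← smul_sub, add_sub_add_left_eq_sub]
    rw [dist_eq_norm, hsub, norm_smul, Real.norm_of_nonneg (Real.exp_pos _).le]
    have he : Real.exp (-(l * (t - a))) * Real.exp (l * (t - a)) = 1 := by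
      rw [← Real.exp_add]; simp
    have hp := Real.exp_pos (-(l * (t - a)))
    have hD : 0 ≤ K * dist y y' / l := by positivity
    calc _ ≤ Real.exp (-(l * (t - a))) *
          (K * dist y y' * (Real.exp (l * (t - a)) / l - 1 / l)) := by gcongr
      _ = (K * dist y y' / l) * (Real.exp (-(l * (t - a))) * Real.exp (l * (t - a)))
          - (K * dist y y' / l) * Real.exp (-(l * (t - a))) := by ring
      _ ≤ K * dist y y' / l := by rw [he]; nlinarith
      _ = _ := by rw [hl]; push_cast; ring
  have : Nonempty C(Icc a b, E) := ⟨0⟩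
  set y := ContractingWith.fixedPoint T hT
  have hy : T y = y := hT.fixedPoint_isFixedPt
  refine ⟨fun t => x₀ + ∫ τ in a..t, g y τ, by simp, fun t ht => ?_⟩
  convert hG y t using 1
  have h1 : IccExtend hab y t = Real.exp (-(l * (t - a))) • (x₀ + ∫ τ in a..t, g y τ) := by
    rw [IccExtend_of_mem hab _ ht]
    conv_lhs => rw [← hy]
    rfl
  change _ = f t _
  rw [h1, smul_smul, ← Real.exp_add]
  simp

/-- Uniqueness on a compact interval for a vector field which is Lipschitz in space, locally uniformly in
time. -/
theorem eqOn_Icc_of_hasDerivWithinAt {f : ℝ → E → E} {s : ℝ}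
    (hK : ∀ b, ∃ K : ℝ≥0, ∀ t ∈ Icc s b, LipschitzWith K (f t)) {b : ℝ} {X Y : ℝ → E}
    (hX : ∀ t ∈ Icc s b, HasDerivWithinAt X (f t (X t)) (Icc s b) t)
    (hY : ∀ t ∈ Icc s b, HasDerivWithinAt Y (f t (Y t)) (Icc s b) t) (h0 : X s = Y s) :
    EqOn X Y (Icc s b) := by
  obtain ⟨K, hK⟩ := hK b
  have key : ∀ {Z : ℝ → E}, (∀ t ∈ Icc s b, HasDerivWithinAt Z (f t (Z t)) (Icc s b) t) →
      ∀ t ∈ Ico s b, HasDerivWithinAt Z (f t (Z t)) (Ici t) t := by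
    intro Z hZ t ht
    refine (hZ t (Ico_subset_Icc_self ht)).mono_of_mem_nhdsWithin ?_
    exact mem_of_superset (Icc_mem_nhdsGE ht.2) (Icc_subset_Icc_left ht.1)
  exact ODE_solution_unique_of_mem_Icc_right (s := fun _ => univ)
    (fun t ht => (hK t (Ico_subset_Icc_self ht)).lipschitzOnWith)
    (fun t ht => (hX t ht).continuousWithinAt) (key hX) (fun _ _ => mem_univ _)
    (fun t ht => (hY t ht).continuousWithinAt) (key hY) (fun _ _ => mem_univ _) h0

/-- Global existence on a half line for a vector field which is Lipschitz in space, locally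
uniformly in time. -/
theorem exists_solution_Ici [CompleteSpace E] {f : ℝ → E → E}
    (hf : Continuous (Function.uncurry f)) {s : ℝ}
    (hK : ∀ b, ∃ K : ℝ≥0, ∀ t ∈ Icc s b, LipschitzWith K (f t)) (x₀ : E) :
    ∃ X : ℝ → E, X s = x₀ ∧ ∀ t ∈ Ici s, HasDerivWithinAt X (f t (X t)) (Ici s) t := by
  have hex : ∀ n : ℕ, ∃ X : ℝ → E, X s = x₀ ∧
      ∀ t ∈ Icc s (s + n), HasDerivAt X (f t (X t)) t := fun n => by
    obtain ⟨K, hK⟩ := hK (s + n)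
    exact exists_solution_Icc hf (by simp) hK x₀
  choose Y hY0 hY using hex
  have hagree : ∀ m n : ℕ, m ≤ n → EqOn (Y m) (Y n) (Icc s (s + m)) := fun m n hmn =>
    eqOn_Icc_of_hasDerivWithinAt hK (fun t ht => (hY m t ht).hasDerivWithinAt)
      (fun t ht => (hY n t ⟨ht.1, ht.2.trans (by gcongr)⟩).hasDerivWithinAt)
      ((hY0 m).trans (hY0 n).symm)
  -- Solutions on nested intervals agree on the smaller one, so each time may use the first interval
  -- that reaches it.
  let X : ℝ → E := fun t => Y ⌈t - s⌉₊ t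
  have hX : ∀ n : ℕ, EqOn X (Y n) (Icc s (s + n)) := by
    intro n t ht
    refine hagree _ n (Nat.ceil_le.2 (by linarith [ht.2])) ⟨ht.1, ?_⟩
    linarith [Nat.le_ceil (t - s)]
  refine ⟨X, by simp [X, hY0], fun t ht => ?_⟩
  obtain ⟨n, hn⟩ := exists_nat_gt (t - s)
  have htn : t ∈ Icc s (s + n) := ⟨ht, by linarith⟩
  have h1 : HasDerivWithinAt X (f t (X t)) (Icc s (s + n)) t := by
    rw [hX n htn]
    exact (hY n t htn).hasDerivWithinAt.congr (hX n) (hX n htn)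
  refine h1.mono_of_mem_nhdsWithin ?_
  rw [← Ici_inter_Iic]
  exact inter_mem_nhdsWithin _ (Iic_mem_nhds (by linarith))

end ODE

/-! ### Position flows, and stability as a criterion for pseudotrajectories -/

section Flow

variable {E : Type*} [NormedAddCommGroup E] [NormedSpace ℝ E]

/-- `β` is bounded on compact intervals. Both forms of the equation are brought to this shape, the
step size entering only through `β`. -/
theorem exists_lipschitzWith_add_smul {A B : E → E} {KA KB : ℝ≥0} (hA : LipschitzWith KA A)
    (hB : LipschitzWith KB B) {β : ℝ → ℝ} (hβ : Continuous β) (a b : ℝ) :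
    ∃ K : ℝ≥0, ∀ t ∈ Icc a b, LipschitzWith K (fun X => A X + β t • B X) := by
  obtain ⟨M, hM⟩ := isCompact_Icc.exists_bound_of_continuousOn (s := Icc a b) hβ.continuousOn
  refine ⟨KA + M.toNNReal * KB, fun t ht => hA.add (LipschitzWith.of_dist_le_mul fun X Y => ?_)⟩
  rw [dist_smul₀, NNReal.coe_mul, mul_assoc]
  exact mul_le_mul ((hM t ht).trans (Real.le_coe_toNNReal M)) (hB.dist_le_mul X Y) dist_nonneg
    (NNReal.coe_nonneg _)

theorem exists_solution_add_smul [CompleteSpace E] {A B : E → E} {KA KB : ℝ≥0}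
    (hA : LipschitzWith KA A) (hB : LipschitzWith KB B) {β : ℝ → ℝ} (hβ : Continuous β)
    (s : ℝ) (X₀ : E) : ∃ X : ℝ → E, X s = X₀ ∧
      ∀ t ∈ Ici s, HasDerivWithinAt X (A (X t) + β t • B (X t)) (Ici s) t := by
  refine exists_solution_Ici (f := fun t X => A X + β t • B X) ?_
    (exists_lipschitzWith_add_smul hA hB hβ s) X₀
  have := hA.continuous
  have := hB.continuous
  simp only [Function.uncurry_def]
  fun_prop

theorem eqOn_Ici_of_hasDerivWithinAt_add_smul {A B : E → E} {KA KB : ℝ≥0}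
    (hA : LipschitzWith KA A) (hB : LipschitzWith KB B) {β : ℝ → ℝ} (hβ : Continuous β)
    {s : ℝ} {X Y : ℝ → E}
    (hX : ∀ t ∈ Ici s, HasDerivWithinAt X (A (X t) + β t • B (X t)) (Ici s) t)
    (hY : ∀ t ∈ Ici s, HasDerivWithinAt Y (A (Y t) + β t • B (Y t)) (Ici s) t)
    (h0 : X s = Y s) : EqOn X Y (Ici s) := fun t ht =>
  eqOn_Icc_of_hasDerivWithinAt (f := fun t X => A X + β t • B X)
    (exists_lipschitzWith_add_smul hA hB hβ s)
    (fun r hr => (hX r hr.1).mono Icc_subset_Ici_self)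
    (fun r hr => (hY r hr.1).mono Icc_subset_Ici_self) h0 ⟨ht, le_refl t⟩

/-- A system whose initial value problems are solvable and whose positions are unique has a
position flow. -/
theorem exists_isPositionFlow {E : Type*} {Sol : ℝ → (ℝ → E) → (ℝ → E) → Prop} {init : E → E}
    (hex : ∀ s, 0 ≤ s → ∀ x, ∃ z y, Sol s z y ∧ z s = x ∧ y s = init x)
    (huniq : ∀ s, 0 ≤ s → ∀ z y z' y', Sol s z y → Sol s z' y' → z s = z' s → y s = y' s →
      EqOn z z' (Ici s)) :
    ∃ Φ, IsPositionFlow Sol init Φ := by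
  choose z y hsol hz hy using hex
  classical
  refine ⟨fun s h x => if hs : 0 ≤ s then z s hs x (s + h) else x, fun s hs x =>
    ⟨⟨_, _, hsol s hs x, hz s hs x, hy s hs x⟩, fun z' y' hsol' hz' hy' h hh => ?_⟩⟩
  simp only [dif_pos hs]
  exact huniq s hs _ _ _ _ (hsol s hs x) hsol' ((hz s hs x).trans hz'.symm)
    ((hy s hs x).trans hy'.symm) (by simpa using hh)

/-- A curve converging to a point which is stable on finite time intervals, uniformly in the
starting time, is an asymptotic pseudotrajectory. -/
theorem IsPositionFlow.isAPT {E : Type*} [NormedAddCommGroup E]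
    {Sol : ℝ → (ℝ → E) → (ℝ → E) → Prop} {init : E → E} {Φ : ℝ → ℝ → E → E}
    (hΦ : IsPositionFlow Sol init Φ) {p : E}
    (hstab : ∀ T, 0 < T → ∃ C : ℝ, ∀ s, 0 ≤ s → ∀ z y, Sol s z y → y s = init (z s) →
      ∀ h ∈ Icc 0 T, ‖z (s + h) - p‖ ≤ C * ‖z s - p‖)
    {x : ℝ → E} (hx : Tendsto x atTop (𝓝 p)) : IsAPT x Φ := by
  intro T hT
  obtain ⟨C, hC⟩ := hstab T hT
  rw [ENNReal.tendsto_nhds_zero]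
  intro ε hε
  obtain ⟨δ, hδ, hδε⟩ : ∃ δ : ℝ, 0 < δ ∧ ENNReal.ofReal δ ≤ ε := by
    rcases eq_or_ne ε ∞ with rfl | h
    · exact ⟨1, one_pos, le_top⟩
    · exact ⟨ε.toReal, ENNReal.toReal_pos hε.ne' h, ENNReal.ofReal_toReal h |>.le⟩
  have hn : Tendsto (fun t => ‖x t - p‖) atTop (𝓝 0) := tendsto_iff_norm_sub_tendsto_zero.1 hx
  -- Control at all later times covers every `t + h` at once.
  have h1 : ∀ᶠ t in atTop, ∀ r ≥ t, ‖x r - p‖ < δ / 2 :=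
    eventually_forall_ge_atTop.2 (hn.eventually_lt_const (half_pos hδ))
  have h2 : ∀ᶠ t in atTop, C * ‖x t - p‖ < δ / 2 := by
    have : Tendsto (fun t => C * ‖x t - p‖) atTop (𝓝 (C * 0)) := hn.const_mul C
    rw [mul_zero] at this
    exact this.eventually_lt_const (half_pos hδ)
  filter_upwards [h1, h2] with t ht1 ht2
  refine iSup₂_le fun s hs => iSup₂_le fun h hh => le_trans ?_ hδε
  obtain ⟨⟨z, y, hsol, hz, hy⟩, huniq⟩ := hΦ s hs (x t)
  rw [huniq z y hsol hz hy h hh.1, ← ofReal_norm]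
  refine ENNReal.ofReal_le_ofReal ?_
  have h3 := hC s hs z y hsol (hz ▸ hy) h hh
  rw [hz] at h3
  have h4 := ht1 (t + h) (by linarith [hh.1])
  calc ‖x (t + h) - z (s + h)‖ = ‖(x (t + h) - p) - (z (s + h) - p)‖ := by congr 1; abel
    _ ≤ ‖x (t + h) - p‖ + ‖z (s + h) - p‖ := norm_sub_le _ _
    _ ≤ δ := by linarith

end Flow

/-! ### The two high-resolution equations: well-posedness and stability at the zero of `V` -/

section HRDE

variable {d : ℕ} {V : EuclideanSpace ℝ (Fin d) → EuclideanSpace ℝ (Fin d)} {L : ℝ≥0} {γ : ℝ → ℝ}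

/-- Freezing `γ` at `γ 0` for negative times gives a coefficient continuous on all of `ℝ`, as the
existence theorem demands. -/
theorem continuous_div_comp_max (hγ : ∀ t, 0 ≤ t → 0 < γ t) (hγc : ContinuousOn γ (Ici 0)) (c : ℝ) :
    Continuous fun t => c / γ (max t 0) := by
  have h : Continuous fun t => γ (max t 0) :=
    hγc.comp_continuous (by fun_prop) fun t => mem_Ici.2 (le_max_right t 0)
  exact continuous_const.div h fun t => (hγ _ (le_max_right _ _)).ne'

/-- In the unknown `u = ω + 2 V(z)` the first form of the high-resolution equation reads
`ż = u - 2 V(z)`, `u̇ = β(t) (V(z) - u)`. -/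
theorem IsHRDESolution.hasDerivWithinAt_add (hV : Differentiable ℝ V) {s : ℝ}
    {z ω : ℝ → EuclideanSpace ℝ (Fin d)} (h : IsHRDESolution V γ s z ω) {t : ℝ} (ht : t ∈ Ici s) :
    HasDerivWithinAt (fun t => ω t + (2 : ℝ) • V (z t))
      ((2 / γ t) • (V (z t) - (ω t + (2 : ℝ) • V (z t)))) (Ici s) t := by
  have h1 := (hV (z t)).hasFDerivAt.comp_hasDerivWithinAt t (h t ht).1
  refine ((h t ht).2.add (h1.const_smul (2 : ℝ))).congr_deriv ?_
  module

theorem isHRDESolution_of_hasDerivWithinAt (hV : Differentiable ℝ V) {s : ℝ}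
    {z u : ℝ → EuclideanSpace ℝ (Fin d)}
    (hz : ∀ t ∈ Ici s, HasDerivWithinAt z (u t - (2 : ℝ) • V (z t)) (Ici s) t)
    (hu : ∀ t ∈ Ici s, HasDerivWithinAt u ((2 / γ t) • (V (z t) - u t)) (Ici s) t) :
    IsHRDESolution V γ s z fun t => u t - (2 : ℝ) • V (z t) := by
  refine fun t ht => ⟨hz t ht, ?_⟩
  have h1 := (hV (z t)).hasFDerivAt.comp_hasDerivWithinAt t (hz t ht)
  refine ((hu t ht).sub (h1.const_smul (2 : ℝ))).congr_deriv ?_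
  module

/-- The term `J(z) ω` need not be Lipschitz. In the unknowns `(z, u)`, `u = ω + 2 V(z)`, it
disappears and the field is `(u - 2 V(z), 0) + β(t) (0, V(z) - u)`; starting at rest becomes `u = 2
V(x)`. -/
theorem exists_isPositionFlow_hrde (hLip : LipschitzWith L V) (hV : Differentiable ℝ V)
    (hγ : ∀ t, 0 ≤ t → 0 < γ t) (hγc : ContinuousOn γ (Ici 0)) :
    ∃ Φ, IsPositionFlow (IsHRDESolution V γ) (fun _ => 0) Φ := by
  have hV1 := hLip.comp (LipschitzWith.prod_fst
    (α := EuclideanSpace ℝ (Fin d)) (β := EuclideanSpace ℝ (Fin d)))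
  have hsnd := LipschitzWith.prod_snd
    (α := EuclideanSpace ℝ (Fin d)) (β := EuclideanSpace ℝ (Fin d))
  have hA := (hsnd.sub (hV1.add hV1)).prodMk
    (LipschitzWith.const (α := EuclideanSpace ℝ (Fin d) × EuclideanSpace ℝ (Fin d))
      (0 : EuclideanSpace ℝ (Fin d)))
  have hB := (LipschitzWith.const (α := EuclideanSpace ℝ (Fin d) × EuclideanSpace ℝ (Fin d))
      (0 : EuclideanSpace ℝ (Fin d))).prodMk (hV1.sub hsnd)
  have hβ := continuous_div_comp_max hγ hγc 2
  have hmax : ∀ {s t : ℝ}, 0 ≤ s → t ∈ Ici s → max t 0 = t := fun hs ht =>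
    max_eq_left (hs.trans ht)
  refine exists_isPositionFlow (fun s hs x => ?_) ?_
  · obtain ⟨X, hX0, hX⟩ := exists_solution_add_smul hA hB hβ s (x, (2 : ℝ) • V x)
    refine ⟨fun t => (X t).1, _, isHRDESolution_of_hasDerivWithinAt (u := fun t => (X t).2) hV
      (fun t ht => ?_) (fun t ht => ?_), by simp [hX0], by simp [hX0]⟩
    · refine (hasFDerivAt_fst.comp_hasDerivWithinAt t (hX t ht)).congr_deriv ?_
      simp [two_smul]
    · refine (hasFDerivAt_snd.comp_hasDerivWithinAt t (hX t ht)).congr_deriv ?_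
      simp [hmax hs ht]
  · intro s hs z y z' y' h h' hz hy
    have key : ∀ {z y : ℝ → EuclideanSpace ℝ (Fin d)}, IsHRDESolution V γ s z y → ∀ t ∈ Ici s,
        HasDerivWithinAt (fun t => (z t, y t + (2 : ℝ) • V (z t)))
          ((y t + (2 : ℝ) • V (z t) - (V (z t) + V (z t)), (0 : EuclideanSpace ℝ (Fin d))) +
            (2 / γ (max t 0)) • ((0 : EuclideanSpace ℝ (Fin d)),
              V (z t) - (y t + (2 : ℝ) • V (z t)))) (Ici s) t := by
      intro z y h t ht
      refine ((h t ht).1.prodMk (h.hasDerivWithinAt_add hV ht)).congr_deriv ?_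
      simp [hmax hs ht, two_smul]
    have := eqOn_Ici_of_hasDerivWithinAt_add_smul hA hB hβ (key h) (key h') (by simp [hz, hy])
    exact fun t ht => congrArg Prod.fst (this ht)

theorem exists_isPositionFlow_hrde2 (hLip : LipschitzWith L V)
    (hγ : ∀ t, 0 ≤ t → 0 < γ t) (hγc : ContinuousOn γ (Ici 0)) :
    ∃ Φ, IsPositionFlow (IsHRDE2Solution V γ) (fun x => -x) Φ := by
  have hV1 := hLip.comp (LipschitzWith.prod_fst
    (α := EuclideanSpace ℝ (Fin d)) (β := EuclideanSpace ℝ (Fin d)))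
  have hfst := LipschitzWith.prod_fst
    (α := EuclideanSpace ℝ (Fin d)) (β := EuclideanSpace ℝ (Fin d))
  have hsnd := LipschitzWith.prod_snd
    (α := EuclideanSpace ℝ (Fin d)) (β := EuclideanSpace ℝ (Fin d))
  have hA := (hV1.add hV1).neg.prodMk
    (LipschitzWith.const (α := EuclideanSpace ℝ (Fin d) × EuclideanSpace ℝ (Fin d))
      (0 : EuclideanSpace ℝ (Fin d)))
  have hB := (hfst.add hsnd).neg.prodMk (hfst.add hsnd).neg
  have hβ := continuous_div_comp_max hγ hγc 1
  have hmax : ∀ {s t : ℝ}, 0 ≤ s → t ∈ Ici s → max t 0 = t := fun hs ht =>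
    max_eq_left (hs.trans ht)
  refine exists_isPositionFlow (fun s hs x => ?_) ?_
  · obtain ⟨X, hX0, hX⟩ := exists_solution_add_smul hA hB hβ s (x, -x)
    refine ⟨fun t => (X t).1, fun t => (X t).2, fun t ht => ⟨?_, ?_⟩, by simp [hX0], by simp [hX0]⟩
    · refine (hasFDerivAt_fst.comp_hasDerivWithinAt t (hX t ht)).congr_deriv ?_
      change -(V (X t).1 + V (X t).1) + (1 / γ (max t 0)) • -((X t).1 + (X t).2) = _
      rw [hmax hs ht]
      module
    · refine (hasFDerivAt_snd.comp_hasDerivWithinAt t (hX t ht)).congr_deriv ?_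
      change 0 + (1 / γ (max t 0)) • -((X t).1 + (X t).2) = _
      rw [hmax hs ht]
      module
  · intro s hs z y z' y' h h' hz hy
    have key : ∀ {z y : ℝ → EuclideanSpace ℝ (Fin d)}, IsHRDE2Solution V γ s z y → ∀ t ∈ Ici s,
        HasDerivWithinAt (fun t => (z t, y t))
          ((-(V (z t) + V (z t)), (0 : EuclideanSpace ℝ (Fin d))) +
            (1 / γ (max t 0)) • (-(z t + y t), -(z t + y t))) (Ici s) t := by
      intro z y h t ht
      refine ((h t ht).1.prodMk (h t ht).2).congr_deriv ?_
      rw [hmax hs ht]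
      ext1 <;> simp only [Prod.fst_add, Prod.smul_fst, Prod.snd_add, Prod.smul_snd] <;> module
    have := eqOn_Ici_of_hasDerivWithinAt_add_smul hA hB hβ (key h) (key h') (by simp [hz, hy])
    exact fun t ht => congrArg Prod.fst (this ht)

theorem StronglyMonotone.inner_nonneg {μ : ℝ} (hmono : StronglyMonotone V μ) (hμ : 0 ≤ μ)
    {p : EuclideanSpace ℝ (Fin d)} (hp : V p = 0) (x : EuclideanSpace ℝ (Fin d)) :
    0 ≤ inner ℝ (x - p) (V x) := by
  have := hmono x p
  rw [hp, sub_zero] at this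
  exact le_trans (by positivity) this

/-- For solutions of the second form of the equation `‖z - p‖² + ‖w + p‖²` does not increase, `p`
being a zero of `V`. -/
theorem IsHRDE2Solution.norm_sub_le {μ : ℝ} (hmono : StronglyMonotone V μ) (hμ : 0 ≤ μ)
    (hγ : ∀ t, 0 ≤ t → 0 < γ t) {p : EuclideanSpace ℝ (Fin d)} (hp : V p = 0) {s : ℝ} (hs : 0 ≤ s)
    {z w : ℝ → EuclideanSpace ℝ (Fin d)} (h : IsHRDE2Solution V γ s z w) (hw : w s = -z s)
    {r : ℝ} (hr : 0 ≤ r) : ‖z (s + r) - p‖ ≤ 2 * ‖z s - p‖ := by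
  have hd : ∀ t ∈ Ici s, HasDerivWithinAt (fun t => ‖z t - p‖ ^ 2 + ‖w t + p‖ ^ 2)
      (2 * inner ℝ (z t - p) (-((1 / γ t) • z t) - (1 / γ t) • w t - (2 : ℝ) • V (z t)) +
        2 * inner ℝ (w t + p) (-((1 / γ t) • z t) - (1 / γ t) • w t)) (Ici s) t := fun t ht =>
    ((h t ht).1.sub_const p).norm_sq.add ((h t ht).2.add_const p).norm_sq
  have hle := image_le_of_deriv_right_le_deriv_boundary (a := s) (b := s + r)
    (B := fun _ => ‖z s - p‖ ^ 2 + ‖w s + p‖ ^ 2) (B' := fun _ => 0)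
    (fun t ht => (hd t ht.1).continuousWithinAt.mono Icc_subset_Ici_self)
    (fun t ht => (hd t ht.1).mono (Ici_subset_Ici.2 ht.1)) le_rfl continuousOn_const
    (fun t _ => hasDerivWithinAt_const _ _ _) (fun t ht => by
      -- The derivative equals `-(2/γ) ‖(z - p) + (w + p)‖² - 4 ⟨z - p, V z⟩`, and both terms are
      -- nonpositive.
      have h1 := hmono.inner_nonneg hμ hp (z t)
      have h2 : 0 < 1 / γ t := one_div_pos.2 (hγ t (hs.trans ht.1))
      have h3 : -((1 / γ t) • z t) - (1 / γ t) • w t =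
        -((1 / γ t) • ((z t - p) + (w t + p))) := by module
      rw [h3, inner_sub_right, inner_neg_right, inner_neg_right, real_inner_smul_right,
        real_inner_smul_right, real_inner_smul_right]
      have h4 : inner ℝ (z t - p) ((z t - p) + (w t + p)) +
          inner ℝ (w t + p) ((z t - p) + (w t + p)) = ‖(z t - p) + (w t + p)‖ ^ 2 := by
        rw [← inner_add_left, real_inner_self_eq_norm_sq]
      have h5 := mul_nonneg h2.le (sq_nonneg ‖(z t - p) + (w t + p)‖)
      rw [← h4] at h5
      linarith) ⟨by linarith, le_rfl⟩
  -- The initial energy is therefore `2 ‖z s - p‖²`; the factor `√2` is rounded up to `2`.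
  have hw' : ‖w s + p‖ = ‖z s - p‖ := by rw [hw, ← norm_neg]; congr 1; abel
  simp only [hw'] at hle
  refine abs_le_of_sq_le_sq' ?_ (by positivity) |>.2
  nlinarith [sq_nonneg ‖w (s + r) + p‖, sq_nonneg ‖z s - p‖]

/-- Below `M` continuity suffices; at `M` the slope decides. With `M` the larger of two values, this
bounds the right Dini derivative of a maximum. -/
theorem HasDerivWithinAt.eventually_lt_add_mul {f : ℝ → ℝ} {f' x M r : ℝ}
    (hf : HasDerivWithinAt f f' (Ici x) x) (hM : f x ≤ M) (hr : f x = M → f' < r) :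
    ∀ᶠ y in 𝓝[>] x, f y < M + r * (y - x) := by
  rcases hM.lt_or_eq with h | h
  · have h1 : Tendsto (fun y => f y - r * (y - x)) (𝓝[>] x) (𝓝 (f x - r * (x - x))) :=
      Tendsto.sub (hf.continuousWithinAt.mono Ioi_subset_Ici_self)
        ((by fun_prop : Continuous fun y => r * (y - x)).continuousAt.tendsto.mono_left
          nhdsWithin_le_nhds)
    filter_upwards [h1.eventually_lt_const (by simpa using h)] with y hy
    linarith
  · have h1 := (hasDerivWithinAt_iff_tendsto_slope' (notMem_Ioi.2 le_rfl)).1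
      (hf.mono Ioi_subset_Ici_self)
    filter_upwards [h1.eventually_lt_const (hr h), self_mem_nhdsWithin] with y hy hxy
    rw [slope_def_field, div_lt_iff₀ (sub_pos.2 hxy)] at hy
    linarith

/-- A Grönwall inequality for the maximum of two functions: only the derivatives of those
realizing the maximum matter. -/
theorem max_le_mul_exp_of_hasDerivWithinAt {f g f' g' : ℝ → ℝ} {K a b : ℝ}
    (hf : ∀ t ∈ Ici a, HasDerivWithinAt f (f' t) (Ici a) t)
    (hg : ∀ t ∈ Ici a, HasDerivWithinAt g (g' t) (Ici a) t)
    (hf' : ∀ t ∈ Ici a, g t ≤ f t → f' t ≤ K * f t)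
    (hg' : ∀ t ∈ Ici a, f t ≤ g t → g' t ≤ K * g t) (hab : a ≤ b) :
    max (f b) (g b) ≤ max (f a) (g a) * Real.exp (K * (b - a)) := by
  rw [← gronwallBound_ε0]
  refine le_gronwallBound_of_liminf_deriv_right_le (f := fun t => max (f t) (g t))
    (f' := fun t => K * max (f t) (g t)) (b := b) (fun t ht => ?_) (fun t ht r hr => ?_)
    le_rfl (fun t _ => by simp) b ⟨hab, le_rfl⟩
  · exact (ContinuousWithinAt.sup (hf t ht.1).continuousWithinAt
      (hg t ht.1).continuousWithinAt).mono Icc_subset_Ici_self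
  · refine Eventually.frequently ?_
    have h1 := ((hf t ht.1).mono (Ici_subset_Ici.2 ht.1)).eventually_lt_add_mul
      (le_max_left (f t) (g t)) (r := r) fun h =>
        (hf' t ht.1 (h ▸ le_max_right _ _)).trans_lt (by rw [h]; exact hr)
    have h2 := ((hg t ht.1).mono (Ici_subset_Ici.2 ht.1)).eventually_lt_add_mul
      (le_max_right (f t) (g t)) (r := r) fun h =>
        (hg' t ht.1 (h ▸ le_max_left _ _)).trans_lt (by rw [h]; exact hr)
    filter_upwards [h1, h2, self_mem_nhdsWithin] with y hy1 hy2 hy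
    rw [inv_mul_lt_iff₀ (sub_pos.2 hy), sub_lt_iff_lt_add']
    exact max_lt (by linarith) (by linarith)

/-- Solutions of the first form of the equation which start at rest stay near a zero `p` of `V`
for finite times, uniformly in the starting time and the step size function. -/
theorem IsHRDESolution.norm_sub_le (hLip : LipschitzWith L V) (hV : Differentiable ℝ V) {μ : ℝ}
    (hmono : StronglyMonotone V μ) (hμ : 0 ≤ μ) (hγ : ∀ t, 0 ≤ t → 0 < γ t)
    {p : EuclideanSpace ℝ (Fin d)} (hp : V p = 0) {s : ℝ} (hs : 0 ≤ s)
    {z ω : ℝ → EuclideanSpace ℝ (Fin d)} (h : IsHRDESolution V γ s z ω) (hω : ω s = 0)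
    {r : ℝ} (hr : 0 ≤ r) :
    ‖z (s + r) - p‖ ≤ 2 * Real.exp ((L + 1) * r) * ‖z s - p‖ := by
  -- The `+ 1` makes `l` positive, so that `l ^ 2` can be cancelled at the end.
  set l : ℝ := L + 1 with hl
  have hl0 : 0 < l := by positivity
  set u : ℝ → EuclideanSpace ℝ (Fin d) := fun t => ω t + (2 : ℝ) • V (z t) with hu
  have hVle : ∀ x, ‖V x‖ ≤ l * ‖x - p‖ := fun x => by
    have h1 := hLip.norm_sub_le x p
    rw [hp, sub_zero] at h1
    exact h1.trans (by gcongr; simp [hl])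
  have hdu : ∀ t ∈ Ici s, HasDerivWithinAt (fun t => ‖u t‖ ^ 2)
      (2 * inner ℝ (u t) ((2 / γ t) • (V (z t) - u t))) (Ici s) t := fun t ht =>
    (h.hasDerivWithinAt_add hV ht).norm_sq
  have hdz : ∀ t ∈ Ici s, HasDerivWithinAt (fun t => l ^ 2 * ‖z t - p‖ ^ 2)
      (l ^ 2 * (2 * inner ℝ (z t - p) (ω t))) (Ici s) t := fun t ht =>
    ((h t ht).1.sub_const p).norm_sq.const_mul _
  -- If `‖u‖` dominates, then `‖V z‖ ≤ l ‖z - p‖ ≤ ‖u‖` and the stiff term does not increase `‖u‖`,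
  -- whatever `γ` is. If `l ‖z - p‖` dominates, monotonicity discards `-2 V(z)` in `ż = u - 2 V(z)`,
  -- leaving growth rate `2 l` for the square.
  have key := max_le_mul_exp_of_hasDerivWithinAt (K := 2 * l) hdu hdz (fun t ht hle => by
      have h1 : l * ‖z t - p‖ ≤ ‖u t‖ := abs_le_of_sq_le_sq' (by nlinarith) (norm_nonneg _) |>.2
      have h2 : inner ℝ (u t) (V (z t) - u t) ≤ 0 := by
        rw [inner_sub_right, real_inner_self_eq_norm_sq]
        have := real_inner_le_norm (u t) (V (z t))
        nlinarith [hVle (z t), norm_nonneg (u t)]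
      have h3 : 0 < 2 / γ t := div_pos two_pos (hγ t (hs.trans ht))
      rw [real_inner_smul_right]
      have h4 := mul_nonpos_of_nonneg_of_nonpos h3.le h2
      have : 0 ≤ 2 * l * ‖u t‖ ^ 2 := by positivity
      linarith)
    (fun t ht hle => by
      have h1 : ‖u t‖ ≤ l * ‖z t - p‖ :=
        abs_le_of_sq_le_sq' (by nlinarith) (by positivity) |>.2
      have h2 : inner ℝ (z t - p) (ω t) ≤ ‖z t - p‖ * ‖u t‖ := by
        have h3 : ω t = u t - (2 : ℝ) • V (z t) := by simp [hu]
        rw [h3, inner_sub_right, real_inner_smul_right]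
        linarith [real_inner_le_norm (z t - p) (u t), hmono.inner_nonneg hμ hp (z t)]
      have h3 : inner ℝ (z t - p) (ω t) ≤ l * ‖z t - p‖ ^ 2 := by
        nlinarith [norm_nonneg (z t - p)]
      calc l ^ 2 * (2 * inner ℝ (z t - p) (ω t)) ≤ l ^ 2 * (2 * (l * ‖z t - p‖ ^ 2)) := by
            gcongr
        _ = _ := by ring)
    (by linarith : s ≤ s + r)
  have hu0 : ‖u s‖ ^ 2 ≤ 4 * (l ^ 2 * ‖z s - p‖ ^ 2) := by
    have : ‖u s‖ ≤ 2 * (l * ‖z s - p‖) := by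
      simp only [hu, hω, zero_add, norm_smul, Real.norm_ofNat]
      linarith [hVle (z s)]
    nlinarith [norm_nonneg (u s)]
  have hm : max (‖u s‖ ^ 2) (l ^ 2 * ‖z s - p‖ ^ 2) ≤ 4 * (l ^ 2 * ‖z s - p‖ ^ 2) :=
    max_le hu0 (by nlinarith [mul_nonneg (sq_nonneg l) (sq_nonneg ‖z s - p‖)])
  have hz := (le_max_right _ _).trans (key.trans (mul_le_mul_of_nonneg_right hm (Real.exp_pos _).le))
  refine abs_le_of_sq_le_sq' ?_ (by positivity) |>.2
  have he : Real.exp (2 * l * (s + r - s)) = Real.exp (l * r) ^ 2 := by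
    rw [← Real.exp_nat_mul]; congr 1; push_cast; ring
  rw [he] at hz
  refine le_of_mul_le_mul_left (hz.trans_eq ?_) (pow_pos hl0 2)
  ring

end HRDE

/-! ### Deterministic convergence of Robbins–Monro schemes -/

section RobbinsMonro

/-- Nonnegative numbers with `s_{n+1} ≤ (1 - c γ_n) s_n + γ_n ε_n`, where `∑ γ_n = ∞` and
`ε_n → 0`, tend to zero. -/
theorem tendsto_zero_of_le_one_sub_mul_add {s γ ε G : ℕ → ℝ} {c : ℝ} (hc : 0 < c)
    (hs : ∀ n, 0 ≤ s n) (hγ : ∀ᶠ n in atTop, 0 ≤ γ n ∧ c * γ n ≤ 1)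
    (hG : ∀ᶠ n in atTop, G (n + 1) = G n + γ n) (hG' : Tendsto G atTop atTop)
    (hε : Tendsto ε atTop (𝓝 0))
    (h : ∀ᶠ n in atTop, s (n + 1) ≤ (1 - c * γ n) * s n + γ n * ε n) :
    Tendsto s atTop (𝓝 0) := by
  refine (tendsto_order.2 ⟨fun a ha => Eventually.of_forall fun n => ha.trans_le (hs n),
    fun η hη => ?_⟩)
  -- Once `ε n` is below this threshold, `s n - η / 2` satisfies the homogeneous recursion and
  -- decays like `exp(-c G n)`.
  have hη' : 0 < c * (η / 2) := by positivity
  obtain ⟨N, hN⟩ := eventually_atTop.1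
    (hγ.and (hG.and (h.and (hε.eventually_lt_const hη'))))
  set D := max (s N - η / 2) 0
  have key : ∀ n ≥ N, s n - η / 2 ≤ D * Real.exp (-(c * (G n - G N))) := by
    intro n hn
    induction n, hn using Nat.le_induction with
    | base => simp [D]
    | succ n hn ih =>
      obtain ⟨⟨h1, h2⟩, h3, h4, h5⟩ := hN n hn
      have h6 : s (n + 1) - η / 2 ≤ (1 - c * γ n) * (s n - η / 2) := by nlinarith
      have h7 : 1 - c * γ n ≤ Real.exp (-(c * γ n)) := by
        linarith [Real.add_one_le_exp (-(c * γ n))]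
      have h8 : Real.exp (-(c * (G (n + 1) - G N))) =
          Real.exp (-(c * γ n)) * Real.exp (-(c * (G n - G N))) := by
        rw [← Real.exp_add, h3]; congr 1; ring
      have h9 : 0 ≤ D * Real.exp (-(c * (G n - G N))) := by positivity
      calc _ ≤ (1 - c * γ n) * (D * Real.exp (-(c * (G n - G N)))) :=
            h6.trans (mul_le_mul_of_nonneg_left ih (by linarith))
        _ ≤ Real.exp (-(c * γ n)) * (D * Real.exp (-(c * (G n - G N)))) :=
            mul_le_mul_of_nonneg_right h7 h9
        _ = _ := by rw [h8]; ring
  have hlim : Tendsto (fun n => D * Real.exp (-(c * (G n - G N)))) atTop (𝓝 (D * 0)) := by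
    refine (Real.tendsto_exp_atBot.comp (tendsto_neg_atTop_atBot.comp ?_)).const_mul D
    exact (tendsto_atTop_add_const_right _ _ hG').const_mul_atTop hc
  rw [mul_zero] at hlim
  filter_upwards [hlim.eventually_lt_const (half_pos hη), eventually_ge_atTop N] with n h1 h2
  linarith [key n h2]

/-- A `μ`-strongly monotone Lipschitz field has a zero. -/
theorem StronglyMonotone.exists_eq_zero {d : ℕ}
    {V : EuclideanSpace ℝ (Fin d) → EuclideanSpace ℝ (Fin d)} {L : ℝ≥0} (hLip : LipschitzWith L V)
    {μ : ℝ} (hμ : 0 < μ) (hmono : StronglyMonotone V μ) : ∃ p, V p = 0 := by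
  -- The map `x ↦ x - η V(x)` shrinks squared distances by `1 - 2ημ + η²L² ≤ 1 - ημ`. The `μ ^ 2`
  -- covers `L = 0` and gives `ημ ≤ 1` without comparing `μ` and `L`.
  set η : ℝ := μ / (L ^ 2 + μ ^ 2) with hη
  have hη0 : 0 < η := by positivity
  have hηL : η * (L ^ 2 + μ ^ 2) = μ := by rw [hη]; field_simp
  have hq0 : 0 ≤ 1 - η * μ := by
    have : η * μ = μ ^ 2 / (L ^ 2 + μ ^ 2) := by rw [hη]; ring
    rw [this, sub_nonneg, div_le_one (by positivity)]
    nlinarith [sq_nonneg (L : ℝ)]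
  have hq1 : Real.sqrt (1 - η * μ) < 1 := by
    rw [Real.sqrt_lt' one_pos]
    nlinarith [mul_pos hη0 hμ]
  have hc : ContractingWith (Real.sqrt (1 - η * μ)).toNNReal fun x => x - η • V x := by
    refine ⟨by rw [Real.toNNReal_lt_one]; exact hq1, LipschitzWith.of_dist_le_mul fun x y => ?_⟩
    rw [Real.coe_toNNReal _ (Real.sqrt_nonneg _), dist_eq_norm, dist_eq_norm]
    refine abs_le_of_sq_le_sq' ?_ (by positivity) |>.2
    rw [mul_pow, Real.sq_sqrt hq0]
    have h1 : x - η • V x - (y - η • V y) = (x - y) - η • (V x - V y) := by module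
    rw [h1, norm_sub_sq_real, real_inner_smul_right, norm_smul, Real.norm_of_nonneg hη0.le, mul_pow]
    have h2 := hmono x y
    have h3 : ‖V x - V y‖ ^ 2 ≤ L ^ 2 * ‖x - y‖ ^ 2 := by
      rw [← mul_pow]
      exact pow_le_pow_left₀ (norm_nonneg _) (hLip.norm_sub_le x y) 2
    have h4 : η ^ 2 * (L ^ 2 * ‖x - y‖ ^ 2) ≤ η * μ * ‖x - y‖ ^ 2 := by
      have : η ^ 2 * L ^ 2 ≤ η * μ := by nlinarith [mul_nonneg hη0.le (sq_nonneg μ)]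
      nlinarith [sq_nonneg ‖x - y‖]
    have h5 := mul_le_mul_of_nonneg_left h3 (sq_nonneg η)
    have h6 := mul_le_mul_of_nonneg_left h2 hη0.le
    nlinarith
  refine ⟨ContractingWith.fixedPoint _ hc, ?_⟩
  have h1 := sub_eq_self.1 hc.fixedPoint_isFixedPt.eq
  exact (smul_eq_zero.1 h1).resolve_left hη0.ne'

/-- The iterates of a Robbins–Monro scheme for a strongly monotone Lipschitz field converge to the
zero of the field when the accumulated perturbation converges. -/
theorem tendsto_of_stronglyMonotone {d : ℕ}
    {V : EuclideanSpace ℝ (Fin d) → EuclideanSpace ℝ (Fin d)} {L : ℝ≥0} (hLip : LipschitzWith L V)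
    {μ : ℝ} (hμ : 0 < μ) (hmono : StronglyMonotone V μ) {p : EuclideanSpace ℝ (Fin d)}
    (hp : V p = 0) {γ : ℕ → ℝ} (hγ : ∀ n, 1 ≤ n → 0 < γ n)
    (hτ : Tendsto (effTime γ) atTop atTop) (hγ0 : Tendsto γ atTop (𝓝 0))
    {z S : ℕ → EuclideanSpace ℝ (Fin d)} {S' : EuclideanSpace ℝ (Fin d)}
    (hS : Tendsto S atTop (𝓝 S'))
    (hz : ∀ n, 1 ≤ n → z (n + 1) = z n - γ n • V (z n) + (S (n + 1) - S n)) :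
    Tendsto z atTop (𝓝 p) := by
  -- Subtracting the remaining perturbation leaves `x (n + 1) = x n - γ n • V (z n)`, with `z n - x
  -- n = S n - S'` tending to zero.
  set x : ℕ → EuclideanSpace ℝ (Fin d) := fun n => z n - S n + S' with hx
  have hδ : Tendsto (fun n => ‖S n - S'‖) atTop (𝓝 0) := tendsto_iff_norm_sub_tendsto_zero.1 hS
  -- Of the contraction rate `2μ`, Young's inequality spends `μ / 2` on the cross term and the
  -- quadratic term `γ² ‖V‖²` costs another `μ / 2`; this is what they leave over.
  have hε : Tendsto (fun n => (2 * L ^ 2 / μ + μ / 2) * ‖S n - S'‖ ^ 2) atTop (𝓝 0) := by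
    simpa using (hδ.pow 2).const_mul (2 * (L : ℝ) ^ 2 / μ + μ / 2)
  have hs1 : ∀ᶠ n in atTop, γ n * (2 * L ^ 2) ≤ μ / 2 := by
    have : Tendsto (fun n => γ n * (2 * (L : ℝ) ^ 2)) atTop (𝓝 (0 * (2 * (L : ℝ) ^ 2))) :=
      hγ0.mul_const _
    rw [zero_mul] at this
    exact (this.eventually_lt_const (half_pos hμ)).mono fun _ h => h.le
  have hs2 : ∀ᶠ n in atTop, μ * γ n ≤ 1 := by
    have : Tendsto (fun n => μ * γ n) atTop (𝓝 (μ * 0)) := hγ0.const_mul _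
    rw [mul_zero] at this
    exact (this.eventually_lt_const one_pos).mono fun _ h => h.le
  have hsq : Tendsto (fun n => ‖x n - p‖ ^ 2) atTop (𝓝 0) := by
    refine tendsto_zero_of_le_one_sub_mul_add hμ (fun n => by positivity)
      (hs2.and (eventually_ge_atTop 1) |>.mono fun n h => ⟨(hγ n h.2).le, h.1⟩)
      ((eventually_ge_atTop 1).mono fun n hn => effTime_succ γ hn) hτ hε ?_
    filter_upwards [hs1, eventually_ge_atTop 1] with n h1 hn
    have hg := hγ n hn
    have hrec : x (n + 1) - p = (x n - p) - γ n • V (z n) := by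
      simp only [hx, hz n hn]; abel
    have hzx : z n - x n = S n - S' := by simp only [hx]; abel
    set a := ‖x n - p‖
    set δ := ‖S n - S'‖
    have hl : ‖V (z n) - V (x n)‖ ≤ L * δ := by
      have := hLip.norm_sub_le (z n) (x n)
      rwa [hzx] at this
    have hv : ‖V (z n)‖ ≤ L * (a + δ) := by
      have h2 := hLip.norm_sub_le (z n) p
      rw [hp, sub_zero] at h2
      refine h2.trans (mul_le_mul_of_nonneg_left ?_ (NNReal.coe_nonneg L))
      calc ‖z n - p‖ = ‖(x n - p) + (S n - S')‖ := by rw [← hzx]; congr 1; abel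
        _ ≤ _ := norm_add_le _ _
    have hin : μ * a ^ 2 - a * (L * δ) ≤ inner ℝ (x n - p) (V (z n)) := by
      have h2 := hmono (x n) p
      rw [hp, sub_zero] at h2
      have h3 : inner ℝ (x n - p) (V (z n)) =
          inner ℝ (x n - p) (V (x n)) + inner ℝ (x n - p) (V (z n) - V (x n)) := by
        rw [← inner_add_right]; congr 1; abel
      have h4 := neg_le_of_abs_le (abs_real_inner_le_norm (x n - p) (V (z n) - V (x n)))
      have h5 := mul_le_mul_of_nonneg_left hl (norm_nonneg (x n - p))
      rw [h3]
      linarith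
    have hv2 : ‖V (z n)‖ ^ 2 ≤ 2 * L ^ 2 * (a ^ 2 + δ ^ 2) := by
      have h2 : ‖V (z n)‖ ^ 2 ≤ (L * (a + δ)) ^ 2 := pow_le_pow_left₀ (norm_nonneg _) hv 2
      nlinarith [sq_nonneg (L * (a - δ))]
    have hY : 2 * (a * (L * δ)) ≤ μ / 2 * a ^ 2 + 2 * L ^ 2 / μ * δ ^ 2 := by
      have h2 : μ / 2 * a ^ 2 + 2 * L ^ 2 / μ * δ ^ 2 - 2 * (a * (L * δ)) =
          (μ * a - 2 * (L * δ)) ^ 2 / (2 * μ) := by field_simp; ring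
      have h3 : 0 ≤ (μ * a - 2 * (L * δ)) ^ 2 / (2 * μ) := by positivity
      linarith
    rw [hrec, norm_sub_sq_real, real_inner_smul_right, norm_smul, Real.norm_of_nonneg hg.le,
      mul_pow]
    have e1 := mul_le_mul_of_nonneg_left hin hg.le
    have e2 := mul_le_mul_of_nonneg_left hv2 (sq_nonneg (γ n))
    have e3 := mul_le_mul_of_nonneg_left hY hg.le
    have e4 := mul_le_mul_of_nonneg_left h1
      (mul_nonneg hg.le (add_nonneg (sq_nonneg a) (sq_nonneg δ)))
    calc a ^ 2 - 2 * (γ n * inner ℝ (x n - p) (V (z n))) + γ n ^ 2 * ‖V (z n)‖ ^ 2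
        ≤ a ^ 2 - 2 * (γ n * (μ * a ^ 2 - a * (L * δ))) +
          γ n ^ 2 * (2 * L ^ 2 * (a ^ 2 + δ ^ 2)) := by linarith
      _ ≤ _ := by linarith
  have hxp : Tendsto x atTop (𝓝 p) := by
    rw [tendsto_iff_norm_sub_tendsto_zero]
    simpa using hsq.sqrt
  have := hxp.add (hS.sub_const S')
  simp only [sub_self, add_zero] at this
  refine this.congr fun n => ?_
  simp only [hx]
  abel

/-- The piecewise linear interpolation of a convergent sequence converges. -/
theorem tendsto_interpolation {E : Type*} [NormedAddCommGroup E] [NormedSpace ℝ E] {γ : ℕ → ℝ}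
    (hγ : ∀ n, 1 ≤ n → 0 < γ n) (hτ : Tendsto (effTime γ) atTop atTop) {x : ℕ → E} {p : E}
    (hx : Tendsto x atTop (𝓝 p)) : Tendsto (interpolation γ x) atTop (𝓝 p) := by
  rw [Metric.tendsto_atTop] at hx ⊢
  intro ε hε
  obtain ⟨N, hN⟩ := hx ε hε
  refine ⟨effTime γ (max N 1), fun t ht => ?_⟩
  -- The predecessor of the least such index starts the segment containing `t`, and both endpoints
  -- of that segment have index at least `N`.
  have hex : ∃ n, t < effTime γ n ∧ max N 1 < n := by
    obtain ⟨n, h1, h2⟩ := ((hτ.eventually_gt_atTop t).and (eventually_gt_atTop (max N 1))).exists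
    exact ⟨n, h1, h2⟩
  classical
  have hfind := Nat.find_spec hex
  obtain ⟨m, hm⟩ : ∃ m, Nat.find hex = m + 1 :=
    Nat.exists_eq_succ_of_ne_zero (by omega)
  rw [hm] at hfind
  have hmt : effTime γ m ≤ t := by
    by_contra! hlt
    rcases (Nat.lt_succ_iff.1 hfind.2).lt_or_eq with h | h
    · exact Nat.find_min hex (by omega : m < Nat.find hex) ⟨hlt, h⟩
    · rw [← h] at hlt
      linarith
  have hm1 : 1 ≤ m := by have := hfind.2; omega
  have hmN : N ≤ m := by have := hfind.2; omega
  have hlt := effTime_lt hγ hm1 (Nat.lt_succ_self m)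
  rw [interpolation_eq hγ x hm1 ⟨hmt, hfind.1.le⟩]
  refine (convex_ball p ε).add_smul_sub_mem (hN m hmN) (hN (m + 1) (by omega))
    ⟨div_nonneg (by linarith) (by linarith), (div_le_one (by linarith)).2 ?_⟩
  linarith [hfind.1]

end RobbinsMonro

/-! ### Almost sure convergence of martingale series -/

section Martingale

/-- A series of martingale differences with summable variances converges almost surely. -/
theorem ae_exists_tendsto_sum_of_condExp_eq_zero {Ω : Type*} {mΩ : MeasurableSpace Ω}
    {P : Measure Ω} [IsProbabilityMeasure P] {𝒢 : Filtration ℕ mΩ} {X : ℕ → Ω → ℝ}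
    (hX : ∀ n, StronglyMeasurable[𝒢 (n + 1)] (X n)) (hX2 : ∀ n, MemLp (X n) 2 P)
    (hX0 : ∀ n, P[X n | 𝒢 n] =ᵐ[P] 0) {C : ℝ}
    (hC : ∀ n, ∑ k ∈ Finset.range n, ∫ ω, X k ω ^ 2 ∂P ≤ C) :
    ∀ᵐ ω ∂P, ∃ c, Tendsto (fun n => ∑ k ∈ Finset.range n, X k ω) atTop (𝓝 c) := by
  set M : ℕ → Ω → ℝ := fun n ω => ∑ k ∈ Finset.range n, X k ω with hM
  have hM2 : ∀ n, MemLp (M n) 2 P := fun n => memLp_finsetSum _ fun k _ => hX2 k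
  have hMm : ∀ n, StronglyMeasurable[𝒢 n] (M n) := fun n =>
    Finset.stronglyMeasurable_fun_sum _ fun k hk =>
      (hX k).mono (𝒢.mono (Nat.succ_le_of_lt (Finset.mem_range.1 hk)))
  have hsucc : ∀ n, M (n + 1) = M n + X n := fun n => by
    ext ω; simp [hM, Finset.sum_range_succ]
  have hmart : Martingale M 𝒢 P := martingale_of_condExp_sub_eq_zero_nat hMm
    (fun n => (hM2 n).integrable one_le_two) fun n => by
      rw [hsucc, add_sub_cancel_left]; exact hX0 n
  -- Increments are orthogonal to the past. The L² bound gives the L¹ bound of the convergence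
  -- theorem through `|x| ≤ 1 + x²`.
  have hvar : ∀ n, ∫ ω, M n ω ^ 2 ∂P = ∑ k ∈ Finset.range n, ∫ ω, X k ω ^ 2 ∂P := by
    intro n
    induction n with
    | zero => simp [hM]
    | succ n ih =>
      have hint : Integrable (M n * X n) P := (hM2 n).integrable_mul (hX2 n)
      have hcross : ∫ ω, (M n * X n) ω ∂P = 0 := by
        rw [← integral_condExp (𝒢.le n)]
        have h1 := condExp_mul_of_stronglyMeasurable_left (hMm n) hint
          ((hX2 n).integrable one_le_two)
        rw [integral_congr_ae (g := 0)]
        · simp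
        · filter_upwards [h1, hX0 n] with ω h2 h3
          rw [h2, Pi.mul_apply, h3]
          simp
      have h1 : (fun ω => M (n + 1) ω ^ 2) =
          fun ω => (M n ω ^ 2 + 2 * (M n * X n) ω) + X n ω ^ 2 := by
        ext ω; rw [hsucc, Pi.add_apply, Pi.mul_apply]; ring
      have h2 : Integrable (fun ω => M n ω ^ 2 + 2 * (M n * X n) ω) P :=
        (hM2 n).integrable_sq.add (hint.const_mul 2)
      rw [h1, integral_add h2 (hX2 n).integrable_sq,
        integral_add (hM2 n).integrable_sq (hint.const_mul 2), integral_const_mul, hcross, ih,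
        Finset.sum_range_succ]
      ring
  refine hmart.submartingale.exists_ae_tendsto_of_bdd (R := (1 + C).toNNReal) fun n => ?_
  rw [eLpNorm_one_eq_lintegral_enorm,
    ← ofReal_integral_norm_eq_lintegral_enorm ((hM2 n).integrable one_le_two)]
  refine ENNReal.ofReal_le_ofReal ?_
  calc ∫ ω, ‖M n ω‖ ∂P ≤ ∫ ω, (1 + M n ω ^ 2) ∂P := by
        refine integral_mono ((hM2 n).integrable one_le_two).norm
          ((integrable_const 1).add (hM2 n).integrable_sq) fun ω => ?_
        simp only [Real.norm_eq_abs]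
        nlinarith [sq_abs (M n ω), sq_nonneg (|M n ω| - 1)]
    _ = 1 + ∑ k ∈ Finset.range n, ∫ ω, X k ω ^ 2 ∂P := by
        rw [integral_add (integrable_const 1) (hM2 n).integrable_sq, hvar]; simp
    _ ≤ 1 + C := by linarith [hC n]

/-- Vector-valued version of `ae_exists_tendsto_sum_of_condExp_eq_zero`. -/
theorem ae_exists_tendsto_sum_of_condExp_eq_zero_euclidean {d : ℕ} {Ω : Type*}
    {mΩ : MeasurableSpace Ω} {P : Measure Ω} [IsProbabilityMeasure P] {𝒢 : Filtration ℕ mΩ}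
    {X : ℕ → Ω → EuclideanSpace ℝ (Fin d)}
    (hX : ∀ n, StronglyMeasurable[𝒢 (n + 1)] (X n)) (hX2 : ∀ n, MemLp (X n) 2 P)
    (hX0 : ∀ n, P[X n | 𝒢 n] =ᵐ[P] 0) {C : ℝ}
    (hC : ∀ n, ∑ k ∈ Finset.range n, ∫ ω, ‖X k ω‖ ^ 2 ∂P ≤ C) :
    ∀ᵐ ω ∂P, ∃ c, Tendsto (fun n => ∑ k ∈ Finset.range n, X k ω) atTop (𝓝 c) := by
  have hi : ∀ i : Fin d, ∀ᵐ ω ∂P, ∃ c : ℝ,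
      Tendsto (fun n => ∑ k ∈ Finset.range n, X k ω i) atTop (𝓝 c) := by
    intro i
    have hle : ∀ n ω, ‖X n ω i‖ ≤ ‖X n ω‖ := fun n ω => PiLp.norm_apply_le _ i
    have h2 : ∀ n, MemLp (fun ω => X n ω i) 2 P := fun n =>
      (hX2 n).mono ((EuclideanSpace.proj (𝕜 := ℝ) i).continuous.comp_aestronglyMeasurable
        (hX2 n).1) (Eventually.of_forall (hle n))
    refine ae_exists_tendsto_sum_of_condExp_eq_zero (X := fun n ω => X n ω i) (C := C)
      (fun n => (EuclideanSpace.proj (𝕜 := ℝ) i).continuous.comp_stronglyMeasurable (hX n)) h2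
      (fun n => ?_) fun n => (Finset.sum_le_sum fun k _ => ?_).trans (hC n)
    · have h1 := (EuclideanSpace.proj (𝕜 := ℝ) i).comp_condExp_comm (m := 𝒢 n)
        ((hX2 n).integrable one_le_two)
      refine (h1.symm : P[fun ω => X n ω i | 𝒢 n] =ᵐ[P] _).trans ?_
      filter_upwards [hX0 n] with ω hω
      simp [hω]
    · refine integral_mono (h2 k).integrable_sq (hX2 k).integrable_norm_pow' fun ω => ?_
      have := pow_le_pow_left₀ (norm_nonneg _) (hle k ω) 2
      simpa using this
  filter_upwards [ae_all_iff.2 hi] with ω hω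
  choose c hc using hω
  refine ⟨WithLp.toLp 2 c, ?_⟩
  have h1 : Tendsto (fun n => (fun i => ∑ k ∈ Finset.range n, X k ω i)) atTop (𝓝 c) :=
    tendsto_pi_nhds.2 hc
  refine (((PiLp.continuous_toLp 2 _).tendsto c).comp h1).congr fun n => ?_
  ext i
  simp

/-- By Tonelli the sum has finite expectation, hence is almost surely finite. -/
theorem ae_summable_of_tsum_lintegral_lt_top {Ω : Type*} {mΩ : MeasurableSpace Ω} {P : Measure Ω}
    {f : ℕ → Ω → ℝ} (hf : ∀ n, AEMeasurable (f n) P) (hf0 : ∀ n ω, 0 ≤ f n ω)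
    (h : ∑' n, ∫⁻ ω, ENNReal.ofReal (f n ω) ∂P < ∞) : ∀ᵐ ω ∂P, Summable fun n => f n ω := by
  rw [← lintegral_tsum fun n => (hf n).ennreal_ofReal] at h
  filter_upwards [ae_lt_top' (AEMeasurable.tsum fun n => (hf n).ennreal_ofReal) h.ne]
    with ω hω
  have h1 := ENNReal.summable_toReal hω.ne
  simpa [ENNReal.toReal_ofReal (hf0 _ ω)] using h1

end Martingale

/-! ### Almost sure convergence of stochastic OGDA -/

section OGDA

variable {d : ℕ} {V : EuclideanSpace ℝ (Fin d) → EuclideanSpace ℝ (Fin d)} {L : ℝ≥0} {γ : ℕ → ℝ}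
  {Ω : Type*} {mΩ : MeasurableSpace Ω} {P : Measure Ω} [IsProbabilityMeasure P]
  {ℱ : Filtration ℕ mΩ} {z R : ℕ → Ω → EuclideanSpace ℝ (Fin d)} {σ : ℕ → Ω → ℝ}

/-- Since `γ n ≠ 0`, the recursion expresses the noise through adapted iterates. -/
theorem IsOGDA.stronglyMeasurable_noise (hV : Continuous V) (hγ : ∀ n, 1 ≤ n → 0 < γ n)
    (hz : IsOGDA V γ R z) (hadapted : ∀ n, StronglyMeasurable[ℱ n] (z n)) {n : ℕ} (hn : 1 ≤ n) :
    StronglyMeasurable[ℱ (n + 1)] (R (n + 1)) := by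
  have hR : R (n + 1) = fun ω => (γ n)⁻¹ •
      (z (n + 1) ω - z n ω + (2 * γ n) • V (z n ω) - γ n • V (z (n - 1) ω)) := by
    ext1 ω
    rw [hz n hn ω, eq_inv_smul_iff₀ (hγ n hn).ne']
    abel
  have h1 := (hadapted n).mono (ℱ.mono (Nat.le_succ n))
  have h2 := (hadapted (n - 1)).mono (ℱ.mono (by omega : n - 1 ≤ n + 1))
  rw [hR]
  have h3 : StronglyMeasurable[ℱ (n + 1)] fun ω => (2 * γ n) • V (z n ω) :=
    (hV.comp_stronglyMeasurable h1).const_smul (2 * γ n)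
  have h4 : StronglyMeasurable[ℱ (n + 1)] fun ω => γ n • V (z (n - 1) ω) :=
    (hV.comp_stronglyMeasurable h2).const_smul (γ n)
  exact ((((hadapted (n + 1)).sub h1).add h3).sub h4).const_smul (γ n)⁻¹

theorem ae_exists_tendsto_sum_noise (hV : Continuous V) (hγ : ∀ n, 1 ≤ n → 0 < γ n)
    (hz : IsOGDA V γ R z) (hadapted : ∀ n, StronglyMeasurable[ℱ n] (z n))
    (hR2 : ∀ n, 1 ≤ n → MemLp (R (n + 1)) 2 P)
    (hRmean : ∀ n, 1 ≤ n → P[R (n + 1) | ℱ n] =ᵐ[P] 0)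
    (hRvar : ∀ n, 1 ≤ n → P[fun ω => ‖R (n + 1) ω‖ ^ 2 | ℱ n] ≤ᵐ[P] fun ω => σ n ω ^ 2)
    (hA2 : ∑' n : ℕ, ∫⁻ ω, ENNReal.ofReal
      (γ (n + 1) ^ 2 * (1 + ‖ogdaBias V z (n + 1) ω‖ ^ 2 + σ (n + 1) ω ^ 2)) ∂P < ∞) :
    ∀ᵐ ω ∂P, ∃ c, Tendsto (fun n => ∑ k ∈ Finset.range n, γ (k + 1) • R (k + 2) ω) atTop
      (𝓝 c) := by
  -- Term `n` of the series carries `R (n + 2)`, centred given `ℱ (n + 1)`; hence the shift.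
  let 𝒢 : Filtration ℕ mΩ :=
    ⟨fun n => ℱ (n + 1), fun m n h => ℱ.mono (Nat.succ_le_succ h), fun n => ℱ.le _⟩
  have hterm : ∀ n, ENNReal.ofReal (∫ ω, ‖γ (n + 1) • R (n + 2) ω‖ ^ 2 ∂P) ≤
      ∫⁻ ω, ENNReal.ofReal
        (γ (n + 1) ^ 2 * (1 + ‖ogdaBias V z (n + 1) ω‖ ^ 2 + σ (n + 1) ω ^ 2)) ∂P := by
    intro n
    have h1 : ∫ ω, ‖γ (n + 1) • R (n + 2) ω‖ ^ 2 ∂P =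
        ∫ ω, γ (n + 1) ^ 2 * (P[fun ω => ‖R (n + 2) ω‖ ^ 2 | ℱ (n + 1)]) ω ∂P := by
      rw [integral_const_mul, integral_condExp (ℱ.le _), ← integral_const_mul]
      simp [norm_smul, mul_pow]
    have h2 : 0 ≤ᵐ[P] P[fun ω => ‖R (n + 2) ω‖ ^ 2 | ℱ (n + 1)] :=
      condExp_nonneg (Eventually.of_forall fun ω => by positivity)
    rw [h1, ofReal_integral_eq_lintegral_ofReal (integrable_condExp.const_mul _)
      (h2.mono fun ω hω => mul_nonneg (sq_nonneg _) hω)]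
    refine lintegral_mono_ae ((hRvar (n + 1) (by omega)).mono fun ω hω => ?_)
    refine ENNReal.ofReal_le_ofReal (mul_le_mul_of_nonneg_left ?_ (sq_nonneg _))
    have : 0 ≤ ‖ogdaBias V z (n + 1) ω‖ ^ 2 := by positivity
    linarith [hω]
  have hmeas : ∀ n, StronglyMeasurable[𝒢 (n + 1)] fun ω => γ (n + 1) • R (n + 2) ω := fun n =>
    (hz.stronglyMeasurable_noise hV hγ hadapted (by omega : 1 ≤ n + 1)).const_smul (γ (n + 1))
  have hLp : ∀ n, MemLp (fun ω => γ (n + 1) • R (n + 2) ω) 2 P := fun n =>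
    (hR2 (n + 1) (by omega)).const_smul (γ (n + 1))
  have hmean : ∀ n, P[fun ω => γ (n + 1) • R (n + 2) ω | 𝒢 n] =ᵐ[P] 0 := by
    intro n
    have h1 : P[γ (n + 1) • R (n + 2) | ℱ (n + 1)] =ᵐ[P] γ (n + 1) • P[R (n + 2) | ℱ (n + 1)] :=
      condExp_smul (γ (n + 1)) (R (n + 2)) (ℱ (n + 1))
    refine h1.trans ?_
    filter_upwards [hRmean (n + 1) (by omega)] with ω hω
    rw [Pi.smul_apply, hω, Pi.zero_apply, smul_zero]
  refine ae_exists_tendsto_sum_of_condExp_eq_zero_euclidean hmeas hLp hmean (C := (∑' n : ℕ,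
    ∫⁻ ω, ENNReal.ofReal (γ (n + 1) ^ 2 *
      (1 + ‖ogdaBias V z (n + 1) ω‖ ^ 2 + σ (n + 1) ω ^ 2)) ∂P).toReal) fun n => ?_
  rw [← ENNReal.ofReal_le_iff_le_toReal hA2.ne,
    ENNReal.ofReal_sum_of_nonneg fun k _ => integral_nonneg fun ω => by positivity]
  exact (Finset.sum_le_sum fun k _ => hterm k).trans (ENNReal.sum_le_tsum _)

/-- The iterates of stochastic OGDA converge almost surely to the zero of `V`. -/
theorem IsOGDA.ae_tendsto (hLip : LipschitzWith L V) {μ : ℝ} (hμ : 0 < μ)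
    (hmono : StronglyMonotone V μ) {p : EuclideanSpace ℝ (Fin d)} (hp : V p = 0)
    (hγ : ∀ n, 1 ≤ n → 0 < γ n) (hτ : Tendsto (effTime γ) atTop atTop)
    (hz : IsOGDA V γ R z) (hadapted : ∀ n, StronglyMeasurable[ℱ n] (z n))
    (hR2 : ∀ n, 1 ≤ n → MemLp (R (n + 1)) 2 P)
    (hRmean : ∀ n, 1 ≤ n → P[R (n + 1) | ℱ n] =ᵐ[P] 0)
    (hRvar : ∀ n, 1 ≤ n → P[fun ω => ‖R (n + 1) ω‖ ^ 2 | ℱ n] ≤ᵐ[P] fun ω => σ n ω ^ 2)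
    (hA1 : Tendsto (fun n => γ n ^ 2) atTop (𝓝 0))
    (hA1' : ∑' n : ℕ, ∫⁻ ω, ENNReal.ofReal
      (γ (n + 1) * ‖ogdaBias V z (n + 1) ω‖) ∂P < ∞)
    (hA2 : ∑' n : ℕ, ∫⁻ ω, ENNReal.ofReal
      (γ (n + 1) ^ 2 * (1 + ‖ogdaBias V z (n + 1) ω‖ ^ 2 + σ (n + 1) ω ^ 2)) ∂P < ∞) :
    ∀ᵐ ω ∂P, Tendsto (fun n => z n ω) atTop (𝓝 p) := by
  have hV := hLip.continuous
  have hγ0 : Tendsto γ atTop (𝓝 0) := by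
    have h1 := hA1.sqrt
    rw [Real.sqrt_zero] at h1
    refine h1.congr' ((eventually_ge_atTop 1).mono fun n hn => Real.sqrt_sq (hγ n hn).le)
  have hzm : ∀ n, StronglyMeasurable (z n) := fun n => (hadapted n).mono (ℱ.le n)
  have hbias : ∀ᵐ ω ∂P, Summable fun n => γ (n + 1) * ‖ogdaBias V z (n + 1) ω‖ := by
    refine ae_summable_of_tsum_lintegral_lt_top (fun n => ?_)
      (fun n ω => mul_nonneg (hγ _ (by omega)).le (norm_nonneg _)) hA1'
    have h1 : StronglyMeasurable (ogdaBias V z (n + 1)) :=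
      (hV.comp_stronglyMeasurable (hzm _)).neg.add (hV.comp_stronglyMeasurable (hzm _))
    exact (h1.norm.measurable.const_mul _).aemeasurable
  filter_upwards [hbias, ae_exists_tendsto_sum_noise hV hγ hz hadapted hR2 hRmean hRvar hA2]
    with ω hω ⟨c, hc⟩
  have hsum : Summable fun n => γ (n + 1) • ogdaBias V z (n + 1) ω := by
    refine Summable.of_norm (hω.congr fun n => ?_)
    rw [norm_smul, Real.norm_of_nonneg (hγ _ (by omega)).le]
  -- Steps are numbered from 1, so the perturbation accumulated before step `n` has `n - 1` terms.
  have hS := ((hsum.hasSum.tendsto_sum_nat).add hc).comp (tendsto_sub_atTop_nat 1)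
  refine tendsto_of_stronglyMonotone hLip hμ hmono hp hγ hτ hγ0 hS fun n hn => ?_
  obtain ⟨m, rfl⟩ := Nat.exists_eq_add_of_le' hn
  simp only [Function.comp_apply, Nat.add_sub_cancel, Finset.sum_range_succ]
  rw [hz (m + 1) hn ω]
  simp only [ogdaBias, Nat.add_sub_cancel]
  module

end OGDA

theorem mainTheorem8 {d : ℕ}
    (V : EuclideanSpace ℝ (Fin d) → EuclideanSpace ℝ (Fin d))
    (L : ℝ≥0) (hLip : LipschitzWith L V) (hC1 : ContDiff ℝ 1 V)
    (μ : ℝ) (hμ : 0 < μ) (hmono : StronglyMonotone V μ)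
    -- the discrete step sizes
    (γ : ℕ → ℝ) (hγ : ∀ n, 1 ≤ n → 0 < γ n) (hτ : Tendsto (effTime γ) atTop atTop)
    -- the step size function of the differential equation
    (γc : ℝ → ℝ) (hγc : ∀ t, 0 ≤ t → 0 < γc t) (hγcd : ContDiffOn ℝ 1 γc (Ici 0))
    -- the iterates and the noise
    {Ω : Type*} [mΩ : MeasurableSpace Ω] (P : Measure Ω) [IsProbabilityMeasure P]
    (ℱ : Filtration ℕ mΩ) (z R : ℕ → Ω → EuclideanSpace ℝ (Fin d)) (σ : ℕ → Ω → ℝ)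
    (hz : IsOGDA V γ R z) (hadapted : ∀ n, StronglyMeasurable[ℱ n] (z n))
    (hR2 : ∀ n, 1 ≤ n → MemLp (R (n + 1)) 2 P)
    (hRmean : ∀ n, 1 ≤ n → P[R (n + 1) | ℱ n] =ᵐ[P] 0)
    (hRvar : ∀ n, 1 ≤ n → P[fun ω => ‖R (n + 1) ω‖ ^ 2 | ℱ n] ≤ᵐ[P] fun ω => σ n ω ^ 2)
    (hA1 : Tendsto (fun n => γ n ^ 2) atTop (𝓝 0))
    (hA1' : ∑' n : ℕ, ∫⁻ ω, ENNReal.ofReal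
      (γ (n + 1) * ‖ogdaBias V z (n + 1) ω‖) ∂P < ∞)
    (hA2 : ∑' n : ℕ, ∫⁻ ω, ENNReal.ofReal
      (γ (n + 1) ^ 2 * (1 + ‖ogdaBias V z (n + 1) ω‖ ^ 2 + σ (n + 1) ω ^ 2)) ∂P < ∞)
    (hA3 : ∀ t, 0 ≤ t → (2 / γc t) * derivWithin (fun s => 2 / γc s) (Ici 0) t < 2 * μ) :
    (∃ Φ : ℝ → ℝ → EuclideanSpace ℝ (Fin d) → EuclideanSpace ℝ (Fin d),
      IsPositionFlow (IsHRDESolution V γc) (fun _ => 0) Φ ∧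
      ∀ᵐ ω ∂P, IsAPT (interpolation γ fun n => z n ω) Φ) ∧
    (∃ Φ : ℝ → ℝ → EuclideanSpace ℝ (Fin d) → EuclideanSpace ℝ (Fin d),
      IsPositionFlow (IsHRDE2Solution V γc) (fun x => -x) Φ ∧
      ∀ᵐ ω ∂P, IsAPT (interpolation γ fun n => z n ω) Φ) := by
  obtain ⟨p, hp⟩ := hmono.exists_eq_zero hLip hμ
  have hV : Differentiable ℝ V := hC1.differentiable one_ne_zero
  have hconv : ∀ᵐ ω ∂P, Tendsto (interpolation γ fun n => z n ω) atTop (𝓝 p) :=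
    (hz.ae_tendsto hLip hμ hmono hp hγ hτ hadapted hR2 hRmean hRvar hA1 hA1' hA2).mono
      fun ω hω => tendsto_interpolation hγ hτ hω
  obtain ⟨Φ₁, h₁⟩ := exists_isPositionFlow_hrde hLip hV hγc hγcd.continuousOn
  obtain ⟨Φ₂, h₂⟩ := exists_isPositionFlow_hrde2 hLip hγc hγcd.continuousOn
  refine ⟨⟨Φ₁, h₁, hconv.mono fun ω hω => h₁.isAPT (fun T _ =>
      ⟨2 * Real.exp ((L + 1) * T), fun s hs z y hsol hy h hh => ?_⟩) hω⟩,
    ⟨Φ₂, h₂, hconv.mono fun ω hω => h₂.isAPT (fun T _ =>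
      ⟨2, fun s hs z y hsol hy h hh => hsol.norm_sub_le hmono hμ.le hγc hp hs hy hh.1⟩) hω⟩⟩
  refine (hsol.norm_sub_le hLip hV hmono hμ.le hγc hp hs hy hh.1).trans ?_
  gcongr
  exact hh.2
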